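/- **Theorem (generic Hoeffding-type bound for exchangeable matrix-valued data).** Let $\|\cdot\|$ be the operator norm (largest singular value) of a real matrix. For $A \in \mathbb{R}^{n\times m}$ put $$\overline{\exp}(A) := \frac{1}{n+m}\operatorname{Tr}\exp\begin{bmatrix} 0 & A\\ A^\top & 0\end{bmatrix},$$ and let $\epsilon_1 := 0$, $\epsilon_n := \frac{H_n-1}{n-H_n}$ for $n\ge 2$, with $H_n := 1+\frac12+\cdots+\frac1n$. Let $N,p,q,r$ be positive integers, let $W_1,\dots,W_N\in\mathbb{R}^{p\times q}$ be fixed matrices, and let $X_1,\dots,X_N$ be random matrices in $\mathbb{R}^{q\times r}$ on a common probability space that are exchangeable, i.e. $(X_1,\dots,X_N)$ and $(X_{\pi(1)},\dots,X_{\pi(N)})$ have the same joint distribution for every permutation $\pi$ of $\{1,\dots,N\}$, and satisfy $\|X_k\|\le 1$ almost surely for every $k$. Write $\overline{W}=\frac1N\sum_{k=1}^N W_k$, $\overline{X}=\frac1N\sum_{k=1}^N X_k$ and $Z=\sum_{k=1}^N W_kX_k-N\,\overline{W}\,\overline{X}$. Then for every $\lambda\in\mathbb{R}$ the random variable $\overline{\exp}(\lambda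 Z)$ is integrable and $$\mathbb{E}\big[\overline{\exp}(\lambda Z)\big]\le \exp\Big(8\lambda^2(1+\epsilon_N)^2\sum_{k=1}^N\|W_k\|^2\Big).$$ Moreover, for every $\delta\in(0,1)$, with $$t_\delta := 4(1+\epsilon_N)\sqrt{2\log\frac{p+r}{\delta}\cdot\sum_{k=1}^N\|W_k\|^2},$$ one has $\mathbb{P}\{\|Z\|\ge t_\delta\}\le\delta$ provided that the $W_k$ are not all zero, and in every case $\mathbb{P}\{\|Z\|\le t_\delta\}\ge 1-\delta$. -/

import Mathlib

open MeasureTheory ProbabilityTheory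
open scoped Matrix Matrix.Norms.L2Operator

/-- The product (entrywise) sigma-algebra on real matrices, which is the Borel one. -/
instance matrixMeasurableSpace {m n : Type*} : MeasurableSpace (Matrix m n ℝ) :=
  inferInstanceAs (MeasurableSpace (m → n → ℝ))

/-- The constants `ε_n`: `ε_1 = 0` and `ε_n = (H_n - 1) / (n - H_n)` for `n ≥ 2`, where
`H_n = 1 + 1/2 + ⋯ + 1/n` is the harmonic number. -/
noncomputable def epsilonConst (n : ℕ) : ℝ :=
  if n ≤ 1 then 0 else ((harmonic n : ℝ) - 1) / ((n : ℝ) - (harmonic n : ℝ))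

/-- The normalized trace exponential of a rectangular real matrix `A` of size `n × m`:
`(n + m)⁻¹ Tr exp [[0, A], [Aᵀ, 0]]`. -/
noncomputable def expBar {n m : ℕ} (A : Matrix (Fin n) (Fin m) ℝ) : ℝ :=
  ((n : ℝ) + (m : ℝ))⁻¹ *
    (NormedSpace.exp (Matrix.fromBlocks (0 : Matrix (Fin n) (Fin n) ℝ) A Aᵀ
      (0 : Matrix (Fin m) (Fin m) ℝ))).trace

/-- The mean `N⁻¹ ∑ₖ Aₖ` of a finite sequence of matrices. -/
noncomputable def matrixMean {N a b : ℕ} (A : Fin N → Matrix (Fin a) (Fin b) ℝ) :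
    Matrix (Fin a) (Fin b) ℝ :=
  (N : ℝ)⁻¹ • ∑ k, A k

/-- The centred weighted sum `∑ₖ Wₖ Xₖ - N W̄ X̄`. -/
noncomputable def centredSum {N p q r : ℕ} (W : Fin N → Matrix (Fin p) (Fin q) ℝ)
    (X : Fin N → Matrix (Fin q) (Fin r) ℝ) : Matrix (Fin p) (Fin r) ℝ :=
  ∑ k, W k * X k - (N : ℝ) • (matrixMean W * matrixMean X)

/-- A finite sequence of random elements is exchangeable if its joint law is invariant under
every permutation of the indices. (`IdentDistrib` includes the almost everywhere measurability
of the sequence.) -/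
def Exchangeable {Ω E : Type*} [MeasurableSpace Ω] [MeasurableSpace E] {N : ℕ}
    (X : Fin N → Ω → E) (μ : Measure Ω) : Prop :=
  ∀ π : Equiv.Perm (Fin N),
    IdentDistrib (fun ω k => X k ω) (fun ω k => X (π k) ω) μ μ

/-! ### Trace inequalities for exponentials of symmetric matrices. -/

section TraceExp

variable {n : Type*} [Fintype n] [DecidableEq n]

/-! Exchangeability makes all expectations of the permuted data equal, so it suffices to bound, for
fixed data x with ‖x k‖ ≤ 1, the average over permutations (`sum_perm_expBar_centredSum_le`). Since
Z is unchanged when W and X are permuted together, the weights may be taken in order of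
nonincreasing norm. Then `centredSum_succ` peels off (W₀ - W̄')(X₀ - X̄), where W̄' is the mean of
the remaining weights. As the datum paired with W₀ varies, these increments sum to zero and have
norm at most 2‖W₀‖ · 2. By `sum_trace_exp_add_le`, averaging tr exp(H + D i) over increments with
zero sum and ‖D i‖ ≤ a costs a factor exp(a²/2), here exp(8‖W₀‖²), and induction on N multiplies
these factors. The resulting bound has no factor (1 + ε_N)², which is at least 1 and only weakens
it. The tail bound is Chernoff's, because exp ‖A‖ is at most the trace exponential of the dilation
of A.

The averaging lemma is a Grönwall argument resting on two trace inequalities, `trace_sub_mul_exp_le`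
and `trace_sub_mul_exp_sub_exp_le`. Both reduce to scalar inequalities: with eigenbases U of A and V
of B, the trace of f(A) g(B) is a sum of f(d a) g(e b) with nonnegative weights (UᵀV)²_{ab}. -/

theorem trace_conj_diagonal_mul_conj_diagonal (U V : Matrix n n ℝ) (f g : n → ℝ) :
    (U * Matrix.diagonal f * Uᵀ * (V * Matrix.diagonal g * Vᵀ)).trace =
      ∑ a, ∑ b, ((Uᵀ * V) a b) ^ 2 * (f a * g b) := by
  have h : (U * Matrix.diagonal f * Uᵀ * (V * Matrix.diagonal g * Vᵀ)).trace =
      ((Matrix.diagonal f * (Uᵀ * V)) * (Matrix.diagonal g * (Uᵀ * V)ᵀ)).trace := by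
    rw [Matrix.transpose_mul, Matrix.transpose_transpose, Matrix.mul_assoc, Matrix.mul_assoc,
      Matrix.trace_mul_comm]
    simp only [Matrix.mul_assoc]
  rw [h, Matrix.trace]
  refine Finset.sum_congr rfl fun a _ => ?_
  rw [Matrix.diag_apply, Matrix.mul_apply]
  refine Finset.sum_congr rfl fun b _ => ?_
  rw [Matrix.diagonal_mul, Matrix.diagonal_mul, Matrix.transpose_apply]
  ring

theorem conj_diagonal_mul_conj_diagonal {U : Matrix n n ℝ} (hU : Uᵀ * U = 1) (f g : n → ℝ) :
    U * Matrix.diagonal f * Uᵀ * (U * Matrix.diagonal g * Uᵀ) =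
      U * Matrix.diagonal (f * g) * Uᵀ := by
  calc U * Matrix.diagonal f * Uᵀ * (U * Matrix.diagonal g * Uᵀ)
      = U * Matrix.diagonal f * (Uᵀ * U) * Matrix.diagonal g * Uᵀ := by
        simp only [Matrix.mul_assoc]
    _ = _ := by
        rw [hU, Matrix.mul_one, Matrix.mul_assoc U, Matrix.diagonal_mul_diagonal]; rfl

theorem exists_conj_diagonal_eq {A : Matrix n n ℝ} (hA : Aᵀ = A) :
    ∃ (U : Matrix n n ℝ) (d : n → ℝ), Uᵀ * U = 1 ∧ A = U * Matrix.diagonal d * Uᵀ := by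
  have hH : A.IsHermitian := by
    rw [Matrix.IsHermitian, Matrix.conjTranspose_eq_transpose_of_trivial, hA]
  refine ⟨hH.eigenvectorUnitary, hH.eigenvalues, ?_, ?_⟩
  · have := Unitary.coe_star_mul_self hH.eigenvectorUnitary
    simpa [Matrix.star_eq_conjTranspose] using this
  · have := hH.spectral_theorem
    simpa [Unitary.conjStarAlgAut_apply, Matrix.star_eq_conjTranspose, Function.comp_def]
      using this

theorem exp_conj_diagonal {U : Matrix n n ℝ} (hU : Uᵀ * U = 1) (d : n → ℝ) :
    NormedSpace.exp (U * Matrix.diagonal d * Uᵀ) =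
      U * Matrix.diagonal (fun i => Real.exp (d i)) * Uᵀ := by
  have hunit : IsUnit U := (Matrix.isUnit_iff_isUnit_det U).2
    (Matrix.isUnit_det_of_left_inverse hU)
  rw [← Matrix.inv_eq_left_inv hU, Matrix.exp_conj _ _ hunit, Matrix.exp_diagonal]
  congr 3
  funext i
  rw [Pi.coe_exp, Real.exp_eq_exp_ℝ]

theorem exists_conj_diagonal_eq_and_exp {A : Matrix n n ℝ} (hA : Aᵀ = A) :
    ∃ (U : Matrix n n ℝ) (d : n → ℝ), Uᵀ * U = 1 ∧ A = U * Matrix.diagonal d * Uᵀ ∧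
      NormedSpace.exp A = U * Matrix.diagonal (fun i => Real.exp (d i)) * Uᵀ := by
  obtain ⟨U, d, hU, h⟩ := exists_conj_diagonal_eq hA
  exact ⟨U, d, hU, h, h ▸ exp_conj_diagonal hU d⟩

/-- Klein's inequality for the exponential. -/
theorem trace_sub_mul_exp_le {A B : Matrix n n ℝ} (hA : Aᵀ = A) (hB : Bᵀ = B) :
    ((B - A) * NormedSpace.exp A).trace ≤
      (NormedSpace.exp B).trace - (NormedSpace.exp A).trace := by
  obtain ⟨U, d, hU, hAd, hAe⟩ := exists_conj_diagonal_eq_and_exp hA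
  obtain ⟨V, e, hV, hBd, hBe⟩ := exists_conj_diagonal_eq_and_exp hB
  have hU1 : U * Matrix.diagonal 1 * Uᵀ = 1 := by
    rw [show Matrix.diagonal (1 : n → ℝ) = 1 from Matrix.diagonal_one, Matrix.mul_one]
    exact mul_eq_one_comm.1 hU
  have hV1 : V * Matrix.diagonal 1 * Vᵀ = 1 := by
    rw [show Matrix.diagonal (1 : n → ℝ) = 1 from Matrix.diagonal_one, Matrix.mul_one]
    exact mul_eq_one_comm.1 hV
  have h1 : (B * NormedSpace.exp A).trace =
      ∑ a, ∑ b, ((Uᵀ * V) a b) ^ 2 * (Real.exp (d a) * e b) := by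
    rw [Matrix.trace_mul_comm, hAe]
    conv_lhs => rw [hBd]
    rw [trace_conj_diagonal_mul_conj_diagonal]
  have h2 : (A * NormedSpace.exp A).trace =
      ∑ a, ∑ b, ((Uᵀ * V) a b) ^ 2 * (d a * Real.exp (d a) * 1) := by
    rw [← Matrix.mul_one (A * NormedSpace.exp A), ← hV1, hAe]
    conv_lhs => rw [hAd]
    rw [conj_diagonal_mul_conj_diagonal hU, trace_conj_diagonal_mul_conj_diagonal]
    rfl
  have h3 : (NormedSpace.exp A).trace =
      ∑ a, ∑ b, ((Uᵀ * V) a b) ^ 2 * (Real.exp (d a) * 1) := by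
    rw [← Matrix.mul_one (NormedSpace.exp A), ← hV1, hAe, trace_conj_diagonal_mul_conj_diagonal]
    rfl
  have h4 : (NormedSpace.exp B).trace =
      ∑ a, ∑ b, ((Uᵀ * V) a b) ^ 2 * (1 * Real.exp (e b)) := by
    rw [← Matrix.one_mul (NormedSpace.exp B), ← hU1, hBe, trace_conj_diagonal_mul_conj_diagonal]
    rfl
  rw [Matrix.sub_mul, Matrix.trace_sub, h1, h2, h3, h4]
  simp only [← Finset.sum_sub_distrib, ← mul_sub]
  refine Finset.sum_le_sum fun a _ => Finset.sum_le_sum fun b _ =>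
    mul_le_mul_of_nonneg_left ?_ (sq_nonneg _)
  -- Scalar convexity: the graph of exp lies above its tangent line at `d a`.
  have h5 := Real.add_one_le_exp (e b - d a)
  have h6 : Real.exp (e b) = Real.exp (d a) * Real.exp (e b - d a) := by
    rw [← Real.exp_add]; ring_nf
  have h7 := Real.exp_pos (d a)
  nlinarith

/-- The trapezoid rule overestimates the integral of the convex function exp. With u = x - y and exp
y factored out, the claim is 0 ≤ u φ(u), where φ is monotone and vanishes at 0. -/
theorem sub_mul_exp_sub_exp_le (x y : ℝ) :
    (x - y) * (Real.exp x - Real.exp y) ≤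
      (x - y) ^ 2 * (Real.exp x + Real.exp y) / 2 := by
  let φ : ℝ → ℝ := fun u => u * (Real.exp u + 1) / 2 - Real.exp u + 1
  have hd (u : ℝ) :
      HasDerivAt φ ((1 * (Real.exp u + 1) + u * Real.exp u) / 2 - Real.exp u) u :=
    ((((hasDerivAt_id u).mul ((Real.hasDerivAt_exp u).add_const 1)).div_const 2).sub
      (Real.hasDerivAt_exp u)).add_const 1
  have hmono : Monotone φ := by
    refine monotone_of_deriv_nonneg (fun u => (hd u).differentiableAt) fun u => ?_
    rw [(hd u).deriv]
    -- φ'(u) = (1 + (u - 1) exp u) / 2, which is nonnegative because exp(-u) ≥ 1 - u.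
    have h1 := Real.add_one_le_exp (-u)
    have h2 := Real.exp_pos u
    have h3 : Real.exp u * Real.exp (-u) = 1 := by rw [← Real.exp_add]; simp
    nlinarith
  have h0 : φ 0 = 0 := by simp [φ]
  have hφ : 0 ≤ (x - y) * φ (x - y) := by
    rcases le_total 0 (x - y) with h | h
    · exact mul_nonneg h (h0 ▸ hmono h)
    · exact mul_nonneg_of_nonpos_of_nonpos h (h0 ▸ hmono h)
  have hx : Real.exp x = Real.exp y * Real.exp (x - y) := by rw [← Real.exp_add]; ring_nf
  have h := mul_nonneg (Real.exp_pos y).le hφ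
  simp only [φ] at h
  rw [hx]
  linarith

/-- The mean value trace inequality for the exponential. -/
theorem trace_sub_mul_exp_sub_exp_le {A B : Matrix n n ℝ} (hA : Aᵀ = A) (hB : Bᵀ = B) :
    ((A - B) * (NormedSpace.exp A - NormedSpace.exp B)).trace ≤
      ((A - B) * (A - B) * (NormedSpace.exp A + NormedSpace.exp B)).trace / 2 := by
  obtain ⟨U, d, hU, hAd, hAe⟩ := exists_conj_diagonal_eq_and_exp hA
  obtain ⟨V, e, hV, hBd, hBe⟩ := exists_conj_diagonal_eq_and_exp hB
  have hU1 : U * Matrix.diagonal 1 * Uᵀ = 1 := by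
    rw [show Matrix.diagonal (1 : n → ℝ) = 1 from Matrix.diagonal_one, Matrix.mul_one]
    exact mul_eq_one_comm.1 hU
  have hV1 : V * Matrix.diagonal 1 * Vᵀ = 1 := by
    rw [show Matrix.diagonal (1 : n → ℝ) = 1 from Matrix.diagonal_one, Matrix.mul_one]
    exact mul_eq_one_comm.1 hV
  set P : (n → ℝ) → Matrix n n ℝ := fun f => U * Matrix.diagonal f * Uᵀ with hP
  set Q : (n → ℝ) → Matrix n n ℝ := fun f => V * Matrix.diagonal f * Vᵀ with hQ
  have hPP (f g) : P f * P g = P (f * g) := conj_diagonal_mul_conj_diagonal hU f g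
  have hQQ (f g) : Q f * Q g = Q (f * g) := conj_diagonal_mul_conj_diagonal hV f g
  have hPQ (f g) : (P f * Q g).trace = ∑ a, ∑ b, ((Uᵀ * V) a b) ^ 2 * (f a * g b) :=
    trace_conj_diagonal_mul_conj_diagonal U V f g
  -- Inserting the identity as `Q 1` or `P 1` puts the unmixed terms into the same double sum as the
  -- mixed ones.
  have hP0 (f) : (P f).trace = (P f * Q 1).trace := by
    rw [show Q 1 = 1 from hV1, Matrix.mul_one]
  have hQ0 (f) : (Q f).trace = (P 1 * Q f).trace := by
    rw [show P 1 = 1 from hU1, Matrix.one_mul]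
  set E : n → ℝ := fun i => Real.exp (d i) with hE
  set F : n → ℝ := fun i => Real.exp (e i) with hF
  rw [hAe, hBe]
  change _ ≤ ((A - B) * (A - B) * (P E + Q F)).trace / 2
  change ((A - B) * (P E - Q F)).trace ≤ _
  replace hAd : A = P d := hAd
  replace hBd : B = Q e := hBd
  rw [hAd, hBd]
  have hl : ((P d - Q e) * (P E - Q F)).trace =
      (P (d * E)).trace - (P E * Q e).trace - (P d * Q F).trace + (Q (e * F)).trace := by
    rw [Matrix.sub_mul, Matrix.mul_sub, Matrix.mul_sub, hPP, hQQ, Matrix.trace_sub,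
      Matrix.trace_sub, Matrix.trace_sub, Matrix.trace_mul_comm (Q e)]
    ring
  have hr : ((P d - Q e) * (P d - Q e) * (P E + Q F)).trace =
      (P (d * d * E)).trace - 2 * (P (d * E) * Q e).trace + (P E * Q (e * e)).trace
      + (P (d * d) * Q F).trace - 2 * (P d * Q (e * F)).trace + (Q (e * e * F)).trace := by
    -- A and B need not commute, but cyclicity of the trace brings every mixed word to the form `P f
    -- * Q g`.
    have e1 : (P d * Q e * P E).trace = (P (d * E) * Q e).trace := by
      rw [Matrix.trace_mul_comm, ← Matrix.mul_assoc, hPP, mul_comm]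
    have e2 : (Q e * P d * P E).trace = (P (d * E) * Q e).trace := by
      rw [Matrix.mul_assoc, hPP, Matrix.trace_mul_comm]
    have e3 : (P d * Q e * Q F).trace = (P d * Q (e * F)).trace := by
      rw [Matrix.mul_assoc, hQQ]
    have e4 : (Q e * P d * Q F).trace = (P d * Q (e * F)).trace := by
      rw [Matrix.mul_assoc, Matrix.trace_mul_comm, Matrix.mul_assoc, hQQ, mul_comm]
    have e5 : (Q (e * e) * P E).trace = (P E * Q (e * e)).trace := Matrix.trace_mul_comm _ _
    have : (P d - Q e) * (P d - Q e) * (P E + Q F) =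
        P (d * d * E) - P d * Q e * P E - Q e * P d * P E + Q (e * e) * P E
        + P (d * d) * Q F - P d * Q e * Q F - Q e * P d * Q F + Q (e * e * F) := by
      simp only [← hPP, ← hQQ]
      noncomm_ring
    rw [this]
    simp only [Matrix.trace_add, Matrix.trace_sub, e1, e2, e3, e4, e5]
    ring
  rw [hl, hr]
  simp only [hP0, hQ0, hPQ, Finset.mul_sum, Finset.sum_div, ← Finset.sum_sub_distrib,
    ← Finset.sum_add_distrib]
  refine Finset.sum_le_sum fun a _ => Finset.sum_le_sum fun b _ => ?_
  have h := mul_le_mul_of_nonneg_left (sub_mul_exp_sub_exp_le (d a) (e b))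
    (sq_nonneg ((Uᵀ * V) a b))
  simp only [Pi.mul_apply, Pi.one_apply, hE, hF]
  linarith

theorem abs_diag_le_l2_opNorm (M : Matrix n n ℝ) (i : n) : |M i i| ≤ ‖M‖ := by
  have h := Matrix.l2_opNorm_mulVec M (EuclideanSpace.single i 1)
  rw [PiLp.norm_single, norm_one, mul_one] at h
  refine le_trans ?_ h
  have h2 := PiLp.norm_apply_le
    (WithLp.toLp 2 (M *ᵥ (EuclideanSpace.single i (1 : ℝ) : EuclideanSpace ℝ n).ofLp)) i
  simpa using h2

theorem l2_opNorm_le_one_of_transpose_mul_self {U : Matrix n n ℝ} (hU : Uᵀ * U = 1) :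
    ‖U‖ ≤ 1 := by
  have h := Matrix.l2_opNorm_conjTranspose_mul_self U
  rw [Matrix.conjTranspose_eq_transpose_of_trivial, hU] at h
  have h1 : ‖(1 : Matrix n n ℝ)‖ ≤ 1 := by
    rw [← Matrix.diagonal_one, Matrix.l2_opNorm_diagonal]
    exact (pi_norm_le_iff_of_nonneg zero_le_one).2 fun _ => by simp
  nlinarith [norm_nonneg U]

theorem l2_opNorm_transpose {m : Type*} [Fintype m] [DecidableEq m] (A : Matrix m n ℝ) :
    ‖Aᵀ‖ = ‖A‖ := by
  rw [← Matrix.conjTranspose_eq_transpose_of_trivial, Matrix.l2_opNorm_conjTranspose]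

theorem l2_opNorm_conj_le {U : Matrix n n ℝ} (hU : Uᵀ * U = 1) (M : Matrix n n ℝ) :
    ‖U * M * Uᵀ‖ ≤ ‖M‖ := by
  have hU1 := l2_opNorm_le_one_of_transpose_mul_self hU
  calc ‖U * M * Uᵀ‖ ≤ ‖U * M‖ * ‖Uᵀ‖ := Matrix.l2_opNorm_mul _ _
    _ ≤ ‖U * M‖ * 1 := by rw [l2_opNorm_transpose]; gcongr
    _ ≤ ‖U‖ * ‖M‖ := by rw [mul_one]; exact Matrix.l2_opNorm_mul _ _
    _ ≤ 1 * ‖M‖ := by gcongr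
    _ = ‖M‖ := one_mul _

theorem trace_conj_diagonal {U : Matrix n n ℝ} (hU : Uᵀ * U = 1) (f : n → ℝ) :
    (U * Matrix.diagonal f * Uᵀ).trace = ∑ a, f a := by
  rw [Matrix.trace_mul_comm, ← Matrix.mul_assoc, hU, Matrix.one_mul, Matrix.trace_diagonal]

/-- In an eigenbasis of A the left side is a sum of diagonal entries of the rotated M with positive
weights exp(d a), and each diagonal entry is at most the norm. -/
theorem trace_mul_exp_le {A : Matrix n n ℝ} (hA : Aᵀ = A) (M : Matrix n n ℝ) :
    (M * NormedSpace.exp A).trace ≤ ‖M‖ * (NormedSpace.exp A).trace := by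
  obtain ⟨U, d, hU, -, hAe⟩ := exists_conj_diagonal_eq_and_exp hA
  have h1 : (M * NormedSpace.exp A).trace = ∑ a, (Uᵀ * M * U) a a * Real.exp (d a) := by
    rw [hAe, ← Matrix.mul_assoc, Matrix.trace_mul_comm, ← Matrix.mul_assoc, ← Matrix.mul_assoc]
    simp [Matrix.trace, Matrix.mul_diagonal]
  have h2 : (NormedSpace.exp A).trace = ∑ a, Real.exp (d a) := by
    rw [hAe, trace_conj_diagonal hU]
  have h3 : ‖Uᵀ * M * U‖ ≤ ‖M‖ := by
    simpa using l2_opNorm_conj_le (U := Uᵀ) (by simpa using mul_eq_one_comm.1 hU) M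
  rw [h1, h2, Finset.mul_sum]
  gcongr with a
  exact (le_abs_self _).trans ((abs_diag_le_l2_opNorm _ a).trans h3)

theorem trace_exp_nonneg {A : Matrix n n ℝ} (hA : Aᵀ = A) : 0 ≤ (NormedSpace.exp A).trace := by
  obtain ⟨U, d, hU, -, hAe⟩ := exists_conj_diagonal_eq_and_exp hA
  rw [hAe, trace_conj_diagonal hU]
  positivity

theorem continuous_exp_matrix :
    Continuous (NormedSpace.exp : Matrix n n ℝ → Matrix n n ℝ) := by
  let _ : NormedAlgebra ℚ (Matrix n n ℝ) := NormedAlgebra.restrictScalars ℚ ℝ _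
  exact NormedSpace.exp_continuous

theorem continuous_trace_exp :
    Continuous fun A : Matrix n n ℝ => (NormedSpace.exp A).trace :=
  continuous_exp_matrix.matrix_trace

/-- The operator norm of a symmetric matrix is controlled by the trace exponentials of the matrix
and of its negative. -/
theorem exp_l2_opNorm_le_of_trace_exp_le {B : Matrix n n ℝ} (hB : Bᵀ = B) {T : ℝ} (hT : 1 ≤ T)
    (hp : (NormedSpace.exp B).trace ≤ T) (hn : (NormedSpace.exp (-B)).trace ≤ T) :
    Real.exp ‖B‖ ≤ T := by
  obtain ⟨U, d, hU, hBd⟩ := exists_conj_diagonal_eq hB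
  have hn' : -B = U * Matrix.diagonal (-d) * Uᵀ := by
    rw [show Matrix.diagonal (-d) = -Matrix.diagonal d from (Matrix.diagonal_neg d).symm,
      Matrix.mul_neg, Matrix.neg_mul, ← hBd]
  rw [hBd, exp_conj_diagonal hU, trace_conj_diagonal hU] at hp
  rw [hn', exp_conj_diagonal hU, trace_conj_diagonal hU] at hn
  rw [← Real.le_log_iff_exp_le (by linarith), hBd]
  refine (l2_opNorm_conj_le hU _).trans ?_
  rw [Matrix.l2_opNorm_diagonal]
  -- The hypothesis `1 ≤ T` has content only for an empty index type, where both traces vanish.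
  refine (pi_norm_le_iff_of_nonneg (Real.log_nonneg hT)).2 fun i => ?_
  rw [Real.norm_eq_abs, abs_le', Real.le_log_iff_exp_le (by linarith),
    Real.le_log_iff_exp_le (by linarith)]
  exact ⟨(Finset.single_le_sum (f := fun a => Real.exp (d a)) (fun a _ => (Real.exp_pos _).le)
      (Finset.mem_univ i)).trans hp,
    (Finset.single_le_sum (f := fun a => Real.exp ((-d) a)) (fun a _ => (Real.exp_pos _).le)
      (Finset.mem_univ i)).trans hn⟩

/-! ### Averages of trace exponentials over increments with zero sum. -/

section Average

variable {ι : Type*} [Fintype ι]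

/-- The derivative along a line of the trace exponential. -/
theorem hasDerivAt_trace_exp {H D : Matrix n n ℝ} (hH : Hᵀ = H) (hD : Dᵀ = D) (t : ℝ) :
    HasDerivAt (fun s : ℝ => (NormedSpace.exp (H + s • D)).trace)
      ((D * NormedSpace.exp (H + t • D)).trace) t := by
  have hsym (s : ℝ) : (H + s • D)ᵀ = H + s • D := by simp [hH, hD]
  -- Klein's inequality used in both directions traps the increment between its linear
  -- approximations at t and at u, so continuity of the candidate derivative suffices and exp itself
  -- is never differentiated.
  have key (s u : ℝ) : (u - s) * (D * NormedSpace.exp (H + s • D)).trace ≤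
      (NormedSpace.exp (H + u • D)).trace - (NormedSpace.exp (H + s • D)).trace := by
    have h := trace_sub_mul_exp_le (hsym s) (hsym u)
    rwa [add_sub_add_left_eq_sub, ← sub_smul, Matrix.smul_mul, Matrix.trace_smul,
      smul_eq_mul] at h
  have hc : Continuous fun s : ℝ => (D * NormedSpace.exp (H + s • D)).trace :=
    (continuous_const.matrix_mul (continuous_exp_matrix.comp (by fun_prop))).matrix_trace
  rw [hasDerivAt_iff_isLittleO, Asymptotics.isLittleO_iff]
  intro c hc0
  obtain ⟨δ, hδ, h1⟩ := Metric.continuousAt_iff.1 (hc.continuousAt (x := t)) c hc0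
  filter_upwards [Metric.ball_mem_nhds t hδ] with u hu
  have h2 := key t u
  have h3 := key u t
  have h4 := (h1 hu).le
  rw [Real.dist_eq] at h4
  rw [Real.norm_eq_abs, Real.norm_eq_abs, smul_eq_mul, abs_of_nonneg (by linarith)]
  refine le_trans ?_ (mul_le_mul_of_nonneg_right h4 (abs_nonneg _))
  rw [← abs_mul]
  refine le_trans ?_ (le_abs_self _)
  linarith

/-- Let g(t) = ∑ tr exp(H + t D i). As the D i sum to zero, exp H may be subtracted inside g'(t);
the mean value inequality then gives g'(t) ≤ (a² t / 2)(g(t) + g(0)). Convexity and the zero sum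
give g(0) ≤ g(t), hence g' ≤ a² t g on t ≥ 0, which integrates to the factor exp(a²/2) at t = 1. -/
theorem sum_trace_exp_add_le {H : Matrix n n ℝ} (hH : Hᵀ = H) {D : ι → Matrix n n ℝ}
    (hD : ∀ i, (D i)ᵀ = D i) (hD0 : ∑ i, D i = 0) {a : ℝ} (ha : ∀ i, ‖D i‖ ≤ a) :
    ∑ i, (NormedSpace.exp (H + D i)).trace ≤
      Fintype.card ι * Real.exp (a ^ 2 / 2) * (NormedSpace.exp H).trace := by
  set T : ℝ → ι → ℝ := fun t i => (NormedSpace.exp (H + t • D i)).trace with hT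
  set g : ℝ → ℝ := fun t => ∑ i, T t i with hg
  set g' : ℝ → ℝ := fun t => ∑ i, (D i * NormedSpace.exp (H + t • D i)).trace with hg'
  have hsym (t : ℝ) (i : ι) : (H + t • D i)ᵀ = H + t • D i := by simp [hH, hD]
  have hder (t : ℝ) : HasDerivAt g (g' t) t :=
    HasDerivAt.fun_sum fun i _ => hasDerivAt_trace_exp hH (hD i) t
  have hg0 : g 0 = Fintype.card ι * (NormedSpace.exp H).trace := by simp [hg, hT]
  have hsum : ∑ i, (D i * NormedSpace.exp H).trace = 0 := by
    rw [← Matrix.trace_sum, ← Finset.sum_mul, hD0, Matrix.zero_mul, Matrix.trace_zero]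
  have hge (t : ℝ) : g 0 ≤ g t := by
    have h (i : ι) : T 0 i + t * (D i * NormedSpace.exp H).trace ≤ T t i := by
      have := trace_sub_mul_exp_le hH (hsym t i)
      rw [add_sub_cancel_left, Matrix.smul_mul, Matrix.trace_smul, smul_eq_mul] at this
      simp only [hT, zero_smul, add_zero]
      linarith
    have := Finset.sum_le_sum fun i (_ : i ∈ Finset.univ) => h i
    rw [Finset.sum_add_distrib, ← Finset.mul_sum, hsum, mul_zero, add_zero] at this
    exact this
  have hle (t : ℝ) (ht : 0 ≤ t) : g' t ≤ a ^ 2 * t * g t := by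
    -- The case t = 0 is separate because a common factor t is cancelled below.
    rcases ht.eq_or_lt with rfl | ht
    · simp [hg', hsum]
    have h (i : ι) : (D i * NormedSpace.exp (H + t • D i)).trace -
        (D i * NormedSpace.exp H).trace ≤ a ^ 2 * t / 2 * (T t i + T 0 i) := by
      have h1 := trace_sub_mul_exp_sub_exp_le (hsym t i) hH
      have hn : ‖D i * D i‖ ≤ a ^ 2 := (Matrix.l2_opNorm_mul _ _).trans <| by
        rw [sq]; exact mul_self_le_mul_self (norm_nonneg _) (ha i)
      have h2 := trace_mul_exp_le (hsym t i) (D i * D i)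
      have h3 := trace_mul_exp_le hH (D i * D i)
      have h4 := mul_le_mul_of_nonneg_right hn (trace_exp_nonneg (hsym t i))
      have h5 := mul_le_mul_of_nonneg_right hn (trace_exp_nonneg hH)
      rw [add_sub_cancel_left, Matrix.smul_mul, Matrix.smul_mul, Matrix.smul_mul, Matrix.mul_smul,
        Matrix.smul_mul, Matrix.trace_smul, Matrix.trace_smul, Matrix.trace_smul, Matrix.mul_sub,
        Matrix.mul_add, Matrix.trace_sub, Matrix.trace_add] at h1
      simp only [smul_eq_mul, mul_div_assoc, mul_le_mul_iff_right₀ ht] at h1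
      simp only [hT, zero_smul, add_zero]
      refine h1.trans ?_
      have := mul_le_mul_of_nonneg_left (add_le_add (h2.trans h4) (h3.trans h5)) ht.le
      linarith
    have h6 := Finset.sum_le_sum fun i (_ : i ∈ Finset.univ) => h i
    rw [Finset.sum_sub_distrib, hsum, sub_zero, ← Finset.mul_sum, Finset.sum_add_distrib] at h6
    refine h6.trans ?_
    have h7 := mul_le_mul_of_nonneg_left (hge t) (show 0 ≤ a ^ 2 * t / 2 by positivity)
    simp only [hg] at h7 ⊢
    linarith
  -- Grönwall: exp(-a² t² / 2) is the integrating factor for g' ≤ a² t g.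
  have hanti : AntitoneOn (fun t => g t * Real.exp (-(a ^ 2 * t ^ 2 / 2))) (Set.Ici 0) := by
    have hd (t : ℝ) : HasDerivAt (fun t => g t * Real.exp (-(a ^ 2 * t ^ 2 / 2)))
        (g' t * Real.exp (-(a ^ 2 * t ^ 2 / 2)) +
          g t * (Real.exp (-(a ^ 2 * t ^ 2 / 2)) * -(a ^ 2 * (2 * t) / 2))) t := by
      refine (hder t).mul (HasDerivAt.exp (HasDerivAt.fun_neg (HasDerivAt.div_const
        (HasDerivAt.const_mul _ ?_) _)))
      simpa using hasDerivAt_pow 2 t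
    refine antitoneOn_of_deriv_nonpos (convex_Ici 0)
      (fun t _ => (hd t).continuousAt.continuousWithinAt)
      (fun t _ => (hd t).differentiableAt.differentiableWithinAt) fun t ht => ?_
    rw [interior_Ici] at ht
    rw [(hd t).deriv]
    have h8 := mul_le_mul_of_nonneg_right (hle t (le_of_lt ht))
      (Real.exp_pos (-(a ^ 2 * t ^ 2 / 2))).le
    linarith
  have h := hanti (Set.mem_Ici.2 le_rfl) (Set.mem_Ici.2 zero_le_one) zero_le_one
  simp only [one_pow, mul_one, ne_eq, OfNat.ofNat_ne_zero, not_false_eq_true, zero_pow, mul_zero,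
    zero_div, neg_zero, Real.exp_zero, Real.exp_neg] at h
  rw [← div_eq_mul_inv, div_le_iff₀ (Real.exp_pos _), hg0] at h
  simp only [hg, hT, one_smul] at h
  linarith

end Average

end TraceExp

/-! ### Symmetric dilations of rectangular matrices. -/

section Dilation

variable {m n : Type*}

/-- The symmetric dilation `[[0, A], [Aᵀ, 0]]` of a rectangular matrix. -/
def symDilation (A : Matrix m n ℝ) : Matrix (m ⊕ n) (m ⊕ n) ℝ :=
  Matrix.fromBlocks 0 A Aᵀ 0

theorem symDilation_transpose (A : Matrix m n ℝ) : (symDilation A)ᵀ = symDilation A := by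
  simp [symDilation, Matrix.fromBlocks_transpose]

theorem symDilation_zero : symDilation (0 : Matrix m n ℝ) = 0 := by
  simp [symDilation]

theorem symDilation_add (A B : Matrix m n ℝ) :
    symDilation (A + B) = symDilation A + symDilation B := by
  simp [symDilation, Matrix.fromBlocks_add]

theorem symDilation_sum {ι : Type*} (s : Finset ι) (A : ι → Matrix m n ℝ) :
    symDilation (∑ i ∈ s, A i) = ∑ i ∈ s, symDilation (A i) :=
  map_sum (AddMonoidHom.mk' (symDilation (m := m) (n := n)) symDilation_add) A s

theorem symDilation_mulVec [Fintype m] [Fintype n] (A : Matrix m n ℝ) (v : m ⊕ n → ℝ) :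
    symDilation A *ᵥ v = Sum.elim (A *ᵥ (v ∘ Sum.inr)) (Aᵀ *ᵥ (v ∘ Sum.inl)) := by
  simp [symDilation, Matrix.fromBlocks_mulVec]

theorem sum_sq_mulVec_le [Fintype m] [Fintype n] [DecidableEq n] (A : Matrix m n ℝ) (v : n → ℝ) :
    ∑ i, (A *ᵥ v) i ^ 2 ≤ ‖A‖ ^ 2 * ∑ j, v j ^ 2 := by
  have h := Matrix.l2_opNorm_mulVec A (WithLp.toLp 2 v)
  have h2 := mul_self_le_mul_self (norm_nonneg _) h
  rw [mul_mul_mul_comm, ← sq, ← sq, ← sq, EuclideanSpace.real_norm_sq_eq,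
    EuclideanSpace.real_norm_sq_eq] at h2
  exact h2

theorem l2_opNorm_le_of_sum_sq_mulVec_le [Fintype m] [Fintype n] [DecidableEq n]
    {A : Matrix m n ℝ} {c : ℝ} (hc : 0 ≤ c)
    (h : ∀ v : n → ℝ, ∑ i, (A *ᵥ v) i ^ 2 ≤ c ^ 2 * ∑ j, v j ^ 2) : ‖A‖ ≤ c := by
  rw [Matrix.l2_opNorm_def]
  refine ContinuousLinearMap.opNorm_le_bound _ hc fun v => ?_
  refine le_of_sq_le_sq ?_ (by positivity)
  rw [mul_pow, EuclideanSpace.real_norm_sq_eq, EuclideanSpace.real_norm_sq_eq]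
  exact h v.ofLp

variable [Fintype m] [DecidableEq m] [Fintype n] [DecidableEq n]

theorem l2_opNorm_symDilation (A : Matrix m n ℝ) : ‖symDilation A‖ = ‖A‖ := by
  apply le_antisymm
  · refine l2_opNorm_le_of_sum_sq_mulVec_le (norm_nonneg _) fun v => ?_
    have h1 := sum_sq_mulVec_le A (v ∘ Sum.inr)
    have h2 := sum_sq_mulVec_le Aᵀ (v ∘ Sum.inl)
    rw [l2_opNorm_transpose] at h2
    simp only [symDilation_mulVec, Fintype.sum_sum_type, Sum.elim_inl, Sum.elim_inr,
      Function.comp_apply] at h1 h2 ⊢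
    linarith
  · refine l2_opNorm_le_of_sum_sq_mulVec_le (norm_nonneg _) fun v => ?_
    have h := sum_sq_mulVec_le (symDilation A) (Sum.elim 0 v)
    simpa [symDilation_mulVec, Fintype.sum_sum_type, Sum.elim_comp_inr, Sum.elim_comp_inl] using h

/-- Conjugation by diag(1, -1) flips the sign of the off-diagonal blocks. Hence one trace
exponential controls both ends of the spectrum. -/
theorem trace_exp_neg_symDilation (A : Matrix m n ℝ) :
    (NormedSpace.exp (-symDilation A)).trace = (NormedSpace.exp (symDilation A)).trace := by
  set J : Matrix (m ⊕ n) (m ⊕ n) ℝ := Matrix.fromBlocks 1 0 0 (-1) with hJ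
  have hJJ : J * J = 1 := by simp [hJ, Matrix.fromBlocks_multiply]
  have h : -symDilation A = J * symDilation A * J⁻¹ := by
    rw [Matrix.inv_eq_left_inv hJJ]
    simp [hJ, symDilation, Matrix.fromBlocks_multiply, Matrix.fromBlocks_neg]
  have hunit : IsUnit J := (Matrix.isUnit_iff_isUnit_det J).2
    (Matrix.isUnit_det_of_left_inverse hJJ)
  rw [h, Matrix.exp_conj _ _ hunit, Matrix.trace_mul_comm, ← Matrix.mul_assoc,
    Matrix.inv_eq_left_inv hJJ, hJJ, Matrix.one_mul]

/-- Klein's inequality at 0, the dilation being traceless. -/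
theorem card_le_trace_exp_symDilation (A : Matrix m n ℝ) :
    (Fintype.card (m ⊕ n) : ℝ) ≤ (NormedSpace.exp (symDilation A)).trace := by
  have h := trace_sub_mul_exp_le (Matrix.transpose_zero (m := m ⊕ n) (n := m ⊕ n) (α := ℝ))
    (symDilation_transpose A)
  simp only [NormedSpace.exp_zero, sub_zero, Matrix.mul_one, Matrix.trace_one] at h
  have h0 : (symDilation A).trace = 0 := by simp [symDilation, Matrix.trace]
  linarith

theorem exp_l2_opNorm_le_trace_exp_symDilation [Nonempty (m ⊕ n)] (A : Matrix m n ℝ) :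
    Real.exp ‖A‖ ≤ (NormedSpace.exp (symDilation A)).trace := by
  rw [← l2_opNorm_symDilation A]
  refine exp_l2_opNorm_le_of_trace_exp_le (symDilation_transpose A) ?_ le_rfl
    (trace_exp_neg_symDilation A).le
  refine le_trans ?_ (card_le_trace_exp_symDilation A)
  exact_mod_cast Fintype.card_pos

end Dilation

/-! ### The centred sum and its average over permutations of the data. -/

section CentredSum

variable {N p q r : ℕ}

theorem smul_matrixMean (A : Fin N → Matrix (Fin p) (Fin q) ℝ) :
    (N : ℝ) • matrixMean A = ∑ k, A k := by
  rcases Nat.eq_zero_or_pos N with rfl | hN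
  · simp
  · rw [matrixMean, smul_inv_smul₀ (by positivity)]

theorem norm_matrixMean_le {A : Fin N → Matrix (Fin p) (Fin q) ℝ} {c : ℝ} (hc : 0 ≤ c)
    (hA : ∀ k, ‖A k‖ ≤ c) : ‖matrixMean A‖ ≤ c := by
  rcases Nat.eq_zero_or_pos N with rfl | hN
  · simpa [matrixMean] using hc
  · have hN' : (0 : ℝ) < N := by positivity
    rw [matrixMean, norm_smul, norm_inv, Real.norm_natCast, inv_mul_le_iff₀ hN']
    refine (norm_sum_le _ _).trans ?_
    simpa using Finset.sum_le_sum fun k (_ : k ∈ Finset.univ) => hA k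

theorem matrixMean_comp_perm (A : Fin N → Matrix (Fin p) (Fin q) ℝ) (π : Equiv.Perm (Fin N)) :
    matrixMean (fun k => A (π k)) = matrixMean A := by
  rw [matrixMean, matrixMean, Equiv.sum_comp π A]

theorem centredSum_eq (W : Fin N → Matrix (Fin p) (Fin q) ℝ)
    (X : Fin N → Matrix (Fin q) (Fin r) ℝ) :
    centredSum W X = ∑ k, W k * X k - (∑ k, W k) * matrixMean X := by
  rw [centredSum, ← smul_matrixMean W, Matrix.smul_mul]

theorem centredSum_comp_perm (W : Fin N → Matrix (Fin p) (Fin q) ℝ)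
    (X : Fin N → Matrix (Fin q) (Fin r) ℝ) (π : Equiv.Perm (Fin N)) :
    centredSum (fun k => W (π k)) (fun k => X (π k)) = centredSum W X := by
  rw [centredSum, centredSum, matrixMean_comp_perm, matrixMean_comp_perm,
    Equiv.sum_comp π fun k => W k * X k]

theorem smul_centredSum (l : ℝ) (W : Fin N → Matrix (Fin p) (Fin q) ℝ)
    (X : Fin N → Matrix (Fin q) (Fin r) ℝ) :
    l • centredSum W X = centredSum (fun k => l • W k) X := by
  simp only [centredSum_eq, smul_sub, ← Finset.smul_sum, Matrix.smul_mul]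

/-- Splitting off the first term of the centred sum. -/
theorem centredSum_succ (W : Fin (N + 1) → Matrix (Fin p) (Fin q) ℝ)
    (X : Fin (N + 1) → Matrix (Fin q) (Fin r) ℝ) :
    centredSum W X = (W 0 - matrixMean fun k : Fin N => W k.succ) * (X 0 - matrixMean X) +
      centredSum (fun k : Fin N => W k.succ) (fun k : Fin N => X k.succ) := by
  have hX := smul_matrixMean X
  rw [Fin.sum_univ_succ, ← smul_matrixMean fun k : Fin N => X k.succ] at hX
  -- Eliminating X 0 in favour of the full mean and the mean of the rest turns the identity into
  -- linear algebra in these means.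
  have hX0 : X 0 = ((N + 1 : ℕ) : ℝ) • matrixMean X -
      (N : ℝ) • matrixMean fun k : Fin N => X k.succ := by rw [hX, add_sub_cancel_right]
  rw [centredSum_eq, centredSum_eq, Fin.sum_univ_succ, Fin.sum_univ_succ,
    ← smul_matrixMean fun k : Fin N => W k.succ, hX0]
  simp only [Nat.cast_add, Nat.cast_one, add_smul, one_smul, Matrix.sub_mul, Matrix.mul_sub,
    Matrix.add_mul, Matrix.mul_add, Matrix.smul_mul, Matrix.mul_smul]
  module

/-- The average of the trace exponential of the centred sum over all permutations of the data,
for weights of nonincreasing norm. -/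
theorem sum_perm_trace_exp_le_of_antitone (W : Fin N → Matrix (Fin p) (Fin q) ℝ)
    (hW : Antitone fun k => ‖W k‖) (x : Fin N → Matrix (Fin q) (Fin r) ℝ)
    (hx : ∀ k, ‖x k‖ ≤ 1) (H : Matrix (Fin p) (Fin r) ℝ) :
    ∑ π : Equiv.Perm (Fin N),
      (NormedSpace.exp (symDilation (H + centredSum W fun k => x (π k)))).trace ≤
    (N.factorial : ℝ) * Real.exp (8 * ∑ k, ‖W k‖ ^ 2) *
      (NormedSpace.exp (symDilation H)).trace := by
  induction N generalizing H with
  | zero => simp [centredSum]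
  | succ N ih =>
    set V := W 0 - matrixMean fun k : Fin N => W k.succ with hV
    set D : Fin (N + 1) → Matrix (Fin p) (Fin r) ℝ := fun i => V * (x i - matrixMean x) with hD
    -- A permutation is a choice i of the datum paired with W 0 and an arrangement σ of the others;
    -- the peeled term `D i` does not depend on σ.
    have hsplit (i : Fin (N + 1)) (σ : Equiv.Perm (Fin N)) :
        H + centredSum W (fun k => x (Equiv.Perm.decomposeFin.symm (i, σ) k)) =
          H + D i + centredSum (fun k : Fin N => W k.succ)
            (fun k => x (Equiv.swap 0 i (σ k).succ)) := by
      rw [centredSum_succ, matrixMean_comp_perm]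
      simp only [Equiv.Perm.decomposeFin_symm_apply_zero,
        Equiv.Perm.decomposeFin_symm_apply_succ, hD, hV, add_assoc]
    -- The ordering of the weights enters here: the mean of the later weights has norm at most ‖W
    -- 0‖.
    have hVn : ‖V‖ ≤ 2 * ‖W 0‖ := by
      have h1 : ‖matrixMean fun k : Fin N => W k.succ‖ ≤ ‖W 0‖ :=
        norm_matrixMean_le (norm_nonneg _) fun k => hW (Fin.zero_le _)
      have h2 := norm_sub_le (W 0) (matrixMean fun k : Fin N => W k.succ)
      linarith
    have hDn (i) : ‖symDilation (D i)‖ ≤ 4 * ‖W 0‖ := by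
      rw [l2_opNorm_symDilation]
      have h1 : ‖x i - matrixMean x‖ ≤ 2 := by
        have h2 := norm_sub_le (x i) (matrixMean x)
        have h3 := norm_matrixMean_le zero_le_one hx
        linarith [hx i]
      calc ‖D i‖ ≤ ‖V‖ * ‖x i - matrixMean x‖ := Matrix.l2_opNorm_mul _ _
        _ ≤ 2 * ‖W 0‖ * 2 := by gcongr
        _ = 4 * ‖W 0‖ := by ring
    have hD0 : ∑ i, symDilation (D i) = 0 := by
      rw [← symDilation_sum, hD, ← Matrix.mul_sum, Finset.sum_sub_distrib, ← smul_matrixMean x,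
        Finset.sum_const, Finset.card_univ, Fintype.card_fin, Nat.cast_smul_eq_nsmul ℝ, sub_self,
        Matrix.mul_zero, symDilation_zero]
    have hstep := sum_trace_exp_add_le (symDilation_transpose H)
      (fun i => symDilation_transpose (D i)) hD0 hDn
    rw [← Equiv.sum_comp Equiv.Perm.decomposeFin.symm, Fintype.sum_prod_type]
    simp only [hsplit]
    -- The sum over σ is bounded first, with `H + D i` as the new base point; this is why H is
    -- general in the induction.
    refine (Finset.sum_le_sum fun i _ => ih (fun k => W k.succ)
      (fun a b h => hW (Fin.succ_le_succ_iff.2 h)) (fun k => x (Equiv.swap 0 i k.succ))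
      (fun k => hx _) (H + D i)).trans ?_
    rw [← Finset.mul_sum]
    simp only [symDilation_add]
    refine (mul_le_mul_of_nonneg_left hstep (by positivity)).trans_eq ?_
    rw [Fin.sum_univ_succ, mul_add, Real.exp_add, Nat.factorial_succ, Fintype.card_fin,
      show (4 * ‖W 0‖) ^ 2 / 2 = 8 * ‖W 0‖ ^ 2 by ring]
    push_cast
    ring

theorem expBar_eq (A : Matrix (Fin p) (Fin q) ℝ) :
    expBar A = ((p : ℝ) + q)⁻¹ * (NormedSpace.exp (symDilation A)).trace := rfl

theorem expBar_nonneg (A : Matrix (Fin p) (Fin q) ℝ) : 0 ≤ expBar A :=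
  mul_nonneg (by positivity) (trace_exp_nonneg (symDilation_transpose A))

theorem continuous_expBar : Continuous (expBar : Matrix (Fin p) (Fin q) ℝ → ℝ) :=
  continuous_const.mul (continuous_trace_exp.comp
    (Continuous.matrix_fromBlocks continuous_const continuous_id
      continuous_id.matrix_transpose continuous_const))

theorem exp_l2_opNorm_le_expBar (hp : 0 < p) (A : Matrix (Fin p) (Fin q) ℝ) :
    Real.exp ‖A‖ ≤ ((p : ℝ) + q) * expBar A := by
  have : Nonempty (Fin p ⊕ Fin q) := ⟨Sum.inl ⟨0, hp⟩⟩
  rw [expBar_eq, mul_inv_cancel_left₀ (by positivity)]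
  exact exp_l2_opNorm_le_trace_exp_symDilation A

theorem sum_perm_expBar_centredSum_le (W : Fin N → Matrix (Fin p) (Fin q) ℝ)
    (x : Fin N → Matrix (Fin q) (Fin r) ℝ) (hx : ∀ k, ‖x k‖ ≤ 1) :
    ∑ π : Equiv.Perm (Fin N), expBar (centredSum W fun k => x (π k)) ≤
      (N.factorial : ℝ) * Real.exp (8 * ∑ k, ‖W k‖ ^ 2) := by
  -- Sorting by -‖W k‖ makes the norms nonincreasing; the sorting permutation is later absorbed by
  -- the reindexing π ↦ π * τ.
  set τ := Tuple.sort fun k => -‖W k‖ with hτ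
  have hanti : Antitone fun k => ‖W (τ k)‖ := fun a b h => by
    have := Tuple.monotone_sort (fun k => -‖W k‖) h
    simpa using this
  have h := sum_perm_trace_exp_le_of_antitone (fun k => W (τ k)) hanti x hx 0
  rw [← Equiv.sum_comp (Equiv.mulRight τ), Equiv.sum_comp τ fun k => ‖W k‖ ^ 2] at h
  simp only [Equiv.coe_mulRight, Equiv.Perm.mul_apply, zero_add, symDilation_zero,
    NormedSpace.exp_zero, Matrix.trace_one, Fintype.card_sum, Fintype.card_fin] at h
  have h1 (π : Equiv.Perm (Fin N)) :
      centredSum (fun k => W (τ k)) (fun k => x (π (τ k))) = centredSum W fun k => x (π k) :=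
    centredSum_comp_perm W (fun k => x (π k)) τ
  simp only [h1] at h
  simp only [expBar_eq, ← Finset.mul_sum]
  refine (mul_le_mul_of_nonneg_left h (by positivity)).trans ?_
  rw [mul_left_comm]
  refine mul_le_of_le_one_right (by positivity) ?_
  rw [Nat.cast_add]
  exact inv_mul_le_one

/-- One nonnegative term is at most the whole permutation sum. The bound is crude, but it gives
integrability. -/
theorem expBar_centredSum_le (W : Fin N → Matrix (Fin p) (Fin q) ℝ)
    (x : Fin N → Matrix (Fin q) (Fin r) ℝ) (hx : ∀ k, ‖x k‖ ≤ 1) :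
    expBar (centredSum W x) ≤ (N.factorial : ℝ) * Real.exp (8 * ∑ k, ‖W k‖ ^ 2) :=
  (Finset.single_le_sum (f := fun π : Equiv.Perm (Fin N) =>
    expBar (centredSum W fun k => x (π k))) (fun _ _ => expBar_nonneg _)
    (Finset.mem_univ 1)).trans (sum_perm_expBar_centredSum_le W x hx)

theorem continuous_centredSum (W : Fin N → Matrix (Fin p) (Fin q) ℝ) :
    Continuous fun x : Fin N → Matrix (Fin q) (Fin r) ℝ => centredSum W x := by
  unfold centredSum matrixMean
  have (k : Fin N) : Continuous fun x : Fin N → Matrix (Fin q) (Fin r) ℝ => W k * x k :=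
    continuous_const.matrix_mul (continuous_apply k)
  have hsum : Continuous fun x : Fin N → Matrix (Fin q) (Fin r) ℝ => ∑ k, x k :=
    continuous_finsetSum _ fun k _ => continuous_apply k
  exact (continuous_finsetSum _ fun k _ => this k).sub
    ((continuous_const.matrix_mul (hsum.fun_const_smul _)).fun_const_smul _)

instance matrixBorelSpace {m n : Type*} [Countable m] [Countable n] : BorelSpace (Matrix m n ℝ) :=
  inferInstanceAs (BorelSpace (m → n → ℝ))

instance matrixSecondCountableTopology {m n : Type*} [Countable m] [Countable n] :
    SecondCountableTopology (Matrix m n ℝ) :=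
  inferInstanceAs (SecondCountableTopology (m → n → ℝ))

theorem measurable_expBar_centredSum (W : Fin N → Matrix (Fin p) (Fin q) ℝ) :
    Measurable fun x : Fin N → Matrix (Fin q) (Fin r) ℝ => expBar (centredSum W x) :=
  (continuous_expBar.comp (continuous_centredSum W)).measurable

end CentredSum

/-- For n ≥ 2 this is 1 ≤ H_n ≤ n. It yields 1 ≤ 1 + ε_N, all that is needed of these constants. -/
theorem epsilonConst_nonneg (n : ℕ) : 0 ≤ epsilonConst n := by
  unfold epsilonConst
  split_ifs with h
  · exact le_rfl
  · refine div_nonneg (sub_nonneg.2 ?_) (sub_nonneg.2 ?_)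
    · have : (1 : ℚ) ≤ harmonic n := by
        have := Finset.single_le_sum (f := fun i : ℕ => ((i + 1 : ℕ) : ℚ)⁻¹)
          (fun i _ => by positivity) (Finset.mem_range.2 (show 0 < n by omega))
        simpa [harmonic] using this
      exact_mod_cast this
    · have : harmonic n ≤ (n : ℚ) := by
        have := Finset.sum_le_card_nsmul (Finset.range n) (fun i : ℕ => ((i + 1 : ℕ) : ℚ)⁻¹) 1
          fun i _ => inv_le_one_of_one_le₀ (by exact_mod_cast Nat.succ_le_succ (Nat.zero_le i))
        simpa [harmonic] using this
      exact_mod_cast this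

/-! ### Moment and tail bounds for exchangeable data. -/

section Exchangeable

variable {Ω : Type*} [MeasurableSpace Ω] {μ : Measure Ω} {N p q r : ℕ}
  {X : Fin N → Ω → Matrix (Fin q) (Fin r) ℝ}

theorem Exchangeable.integrable_expBar_centredSum [IsFiniteMeasure μ] (hX : Exchangeable X μ)
    (hX1 : ∀ k, ∀ᵐ ω ∂μ, ‖X k ω‖ ≤ 1) (W : Fin N → Matrix (Fin p) (Fin q) ℝ) :
    Integrable (fun ω => expBar (centredSum W fun k => X k ω)) μ := by
  refine Integrable.of_bound
    ((measurable_expBar_centredSum W).comp_aemeasurable (hX 1).aemeasurable_fst).aestronglyMeasurable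
    ((N.factorial : ℝ) * Real.exp (8 * ∑ k, ‖W k‖ ^ 2)) ?_
  filter_upwards [ae_all_iff.2 hX1] with ω hω
  rw [Real.norm_of_nonneg (expBar_nonneg _)]
  exact expBar_centredSum_le W _ hω

/-- All N! permuted expectations coincide, so integrating the almost sure bound on the permutation
sum and dividing by N! gives the claim. -/
theorem Exchangeable.integral_expBar_centredSum_le [IsProbabilityMeasure μ]
    (hX : Exchangeable X μ) (hX1 : ∀ k, ∀ᵐ ω ∂μ, ‖X k ω‖ ≤ 1)
    (W : Fin N → Matrix (Fin p) (Fin q) ℝ) :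
    ∫ ω, expBar (centredSum W fun k => X k ω) ∂μ ≤ Real.exp (8 * ∑ k, ‖W k‖ ^ 2) := by
  have hid (π : Equiv.Perm (Fin N)) :
      IdentDistrib (fun ω => expBar (centredSum W fun k => X k ω))
        (fun ω => expBar (centredSum W fun k => X (π k) ω)) μ μ :=
    (hX π).comp (measurable_expBar_centredSum W)
  have hint := hX.integrable_expBar_centredSum hX1 W
  have h : ∑ π : Equiv.Perm (Fin N), ∫ ω, expBar (centredSum W fun k => X (π k) ω) ∂μ ≤
      (N.factorial : ℝ) * Real.exp (8 * ∑ k, ‖W k‖ ^ 2) := by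
    rw [← integral_finsetSum _ fun π _ => (hid π).integrable_iff.1 hint]
    have hc : ∫ _ : Ω, (N.factorial : ℝ) * Real.exp (8 * ∑ k, ‖W k‖ ^ 2) ∂μ =
        (N.factorial : ℝ) * Real.exp (8 * ∑ k, ‖W k‖ ^ 2) := by simp
    rw [← hc]
    refine integral_mono_ae (integrable_finsetSum _ fun π _ => (hid π).integrable_iff.1 hint)
      (integrable_const _) ?_
    filter_upwards [ae_all_iff.2 hX1] with ω hω
    exact sum_perm_expBar_centredSum_le W (fun k => X k ω) hω
  simp only [← (hid _).integral_eq, Finset.sum_const, Finset.card_univ, Fintype.card_perm,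
    Fintype.card_fin, nsmul_eq_mul] at h
  exact le_of_mul_le_mul_left h (by positivity)

/-- Chernoff bound for the operator norm of a random matrix. -/
theorem measureReal_l2_opNorm_ge_le {Z : Ω → Matrix (Fin p) (Fin r) ℝ} [IsFiniteMeasure μ]
    (hp : 0 < p) {l t b : ℝ} (hl : 0 ≤ l) (hint : Integrable (fun ω => expBar (l • Z ω)) μ)
    (hb : ∫ ω, expBar (l • Z ω) ∂μ ≤ Real.exp b) :
    μ.real {ω | ‖Z ω‖ ≥ t} ≤ (p + r) * Real.exp (b - l * t) := by
  have hpr : (0 : ℝ) < p + r := by positivity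
  have h := mul_meas_ge_le_integral_of_nonneg (μ := μ)
    (f := fun ω => ((p : ℝ) + r) * expBar (l • Z ω))
    (Filter.Eventually.of_forall fun ω => mul_nonneg hpr.le (expBar_nonneg _))
    (hint.const_mul _) (Real.exp (l * t))
  rw [integral_const_mul] at h
  have hsub : {ω | ‖Z ω‖ ≥ t} ⊆ {ω | Real.exp (l * t) ≤ ((p : ℝ) + r) * expBar (l • Z ω)} := by
    intro ω hω
    refine le_trans (Real.exp_le_exp.2 ?_) (exp_l2_opNorm_le_expBar hp _)
    rw [norm_smul, Real.norm_of_nonneg hl]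
    exact mul_le_mul_of_nonneg_left hω hl
  have h2 : Real.exp (l * t) * μ.real {ω | ‖Z ω‖ ≥ t} ≤ (p + r) * Real.exp b :=
    (mul_le_mul_of_nonneg_left (measureReal_mono hsub) (Real.exp_pos _).le).trans
      (h.trans (mul_le_mul_of_nonneg_left hb hpr.le))
  rw [Real.exp_sub, ← mul_div_assoc, le_div_iff₀ (Real.exp_pos _)]
  linarith

end Exchangeable

theorem mainTheorem5 {Ω : Type*} [MeasurableSpace Ω] (μ : Measure Ω) [IsProbabilityMeasure μ]
    (N p q r : ℕ) (hN : 0 < N) (hp : 0 < p) (hq : 0 < q) (hr : 0 < r)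
    (W : Fin N → Matrix (Fin p) (Fin q) ℝ)
    (X : Fin N → Ω → Matrix (Fin q) (Fin r) ℝ)
    (hX : Exchangeable X μ)
    (hX1 : ∀ k, ∀ᵐ ω ∂μ, ‖X k ω‖ ≤ 1) :
    (∀ l : ℝ,
      Integrable (fun ω => expBar (l • centredSum W (fun k => X k ω))) μ ∧
      ∫ ω, expBar (l • centredSum W (fun k => X k ω)) ∂μ ≤
        Real.exp (8 * l ^ 2 * (1 + epsilonConst N) ^ 2 * ∑ k, ‖W k‖ ^ 2)) ∧
    (∀ δ : ℝ, 0 < δ → δ < 1 →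
      ((∃ k, W k ≠ 0) →
        μ.real {ω | ‖centredSum W (fun k => X k ω)‖ ≥
          4 * (1 + epsilonConst N) *
            √(2 * Real.log (((p : ℝ) + (r : ℝ)) / δ) * ∑ k, ‖W k‖ ^ 2)} ≤ δ) ∧
      μ.real {ω | ‖centredSum W (fun k => X k ω)‖ ≤
          4 * (1 + epsilonConst N) *
            √(2 * Real.log (((p : ℝ) + (r : ℝ)) / δ) * ∑ k, ‖W k‖ ^ 2)} ≥ 1 - δ) := by
  set K := 1 + epsilonConst N with hKdef
  have hK : 1 ≤ K := le_add_of_nonneg_right (epsilonConst_nonneg N)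
  set V := ∑ k, ‖W k‖ ^ 2 with hVdef
  have hV0 : 0 ≤ V := by positivity
  have hmgf : ∀ l : ℝ,
      Integrable (fun ω => expBar (l • centredSum W (fun k => X k ω))) μ ∧
      ∫ ω, expBar (l • centredSum W (fun k => X k ω)) ∂μ ≤
        Real.exp (8 * l ^ 2 * K ^ 2 * V) := by
    intro l
    simp only [smul_centredSum]
    refine ⟨hX.integrable_expBar_centredSum hX1 _,
      (hX.integral_expBar_centredSum_le hX1 _).trans (Real.exp_le_exp.2 ?_)⟩
    simp only [norm_smul, mul_pow, ← Finset.mul_sum, Real.norm_eq_abs, sq_abs]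
    have : l ^ 2 * V * 1 ≤ l ^ 2 * V * K ^ 2 := by gcongr; exact one_le_pow₀ hK
    linarith
  refine ⟨hmgf, fun δ hδ hδ1 => ?_⟩
  set L := Real.log (((p : ℝ) + (r : ℝ)) / δ) with hL
  have hpr : (0 : ℝ) < (p : ℝ) + r := by positivity
  have hL0 : 0 ≤ L := by
    refine Real.log_nonneg ((one_le_div hδ).2 (hδ1.le.trans ?_))
    exact_mod_cast (show 1 ≤ p + r by omega)
  set t := 4 * K * √(2 * L * V) with ht
  have ht0 : 0 ≤ t := by positivity
  have htail : (∃ k, W k ≠ 0) →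
      μ.real {ω | ‖centredSum W (fun k => X k ω)‖ ≥ t} ≤ δ := by
    rintro ⟨k, hk⟩
    have hV : 0 < V := Finset.sum_pos' (fun _ _ => by positivity)
      ⟨k, Finset.mem_univ _, by have := norm_pos_iff.2 hk; positivity⟩
    -- This l minimises the Chernoff exponent 8 l² K² V - l t, whose minimum -t² / (32 K² V) equals
    -- -L by the choice of t.
    have hl := hmgf (t / (16 * K ^ 2 * V))
    refine (measureReal_l2_opNorm_ge_le (t := t) hp (by positivity) hl.1 hl.2).trans_eq ?_
    have ht2 : t ^ 2 = 32 * K ^ 2 * V * L := by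
      rw [ht, mul_pow, Real.sq_sqrt (by positivity)]; ring
    have hexp : 8 * (t / (16 * K ^ 2 * V)) ^ 2 * K ^ 2 * V - t / (16 * K ^ 2 * V) * t = -L := by
      have : 8 * (t / (16 * K ^ 2 * V)) ^ 2 * K ^ 2 * V - t / (16 * K ^ 2 * V) * t =
          -(t ^ 2 / (32 * K ^ 2 * V)) := by field_simp; ring
      rw [this, ht2, mul_div_cancel_left₀ _ (by positivity)]
    rw [hexp, hL, Real.exp_neg, Real.exp_log (by positivity), inv_div, mul_div_cancel₀ _ hpr.ne']
  refine ⟨htail, ?_⟩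
  by_cases hW : ∃ k, W k ≠ 0
  · have hcover : (Set.univ : Set Ω) ⊆ {ω | ‖centredSum W (fun k => X k ω)‖ ≥ t} ∪
        {ω | ‖centredSum W (fun k => X k ω)‖ ≤ t} := fun ω _ =>
      le_total t ‖centredSum W (fun k => X k ω)‖
    have h1 := (measureReal_mono (μ := μ) hcover).trans (measureReal_union_le _ _)
    rw [probReal_univ] at h1
    have := htail hW
    linarith
  -- If all weights vanish then Z = 0 and t = 0, so only the non-strict event can be controlled.
  · push Not at hW
    have huniv : {ω | ‖centredSum W (fun k => X k ω)‖ ≤ t} = Set.univ := by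
      refine Set.eq_univ_of_forall fun ω => ?_
      simpa [centredSum_eq, hW] using ht0
    rw [huniv, probReal_univ]
    linarith
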